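/- Consider an $N$-dimensional quantum system whose density matrix obeys the master equation $$\dot\rho(t)=\mathcal L(\mathbf u(t))\rho(t),\quad \rho(t_{\rm i})=\rho_0,\qquad \mathcal L(\mathbf u)=\mathcal L_0+\sum_{j=1}^{m}u_j\mathcal L_j ,$$ where $\rho_0$ is a given density matrix, the controls $u_j(t)$ are integrable functions of time with $u_{\min,j}\le u_j(t)\le u_{\max,j}$, and the $\mathcal L_j$ are linear superoperators such that, for all admissible values of $\mathbf u$, $\mathcal L(\mathbf u)$ generates a trace- and Hermiticity-preserving evolution. The terminal control problem is to maximize $J=\operatorname{Tr}[O\rho(T)]$, with $O$ a given Hermitian observable, at a fixed or free final time $T\ge t_{\rm i}$. Let $(\tilde{\mathbf u},T,\tilde\rho)$ be an optimal process with performance index $\tilde J$, and let $\tilde\psi$ be its costate, i.e. the solution on $[t_{\rm i},T]$ of $\dot\psi=-\partial K/\partial\rho$ with $\tilde\psi(T)=O-\tilde J\,\mathbb 1$, where $K(\rho,\mathbf u,\psi)=\operatorname{Tr}[\psi\,\mathcal L(\mathbf u)\rho]$. An interval $(t_1,t_2)$ with $t_{\rm i}\le t_1<t_2\le T$ is called a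 singular subarc of $\tilde u_k$ if the switching function $\partial K/\partial u_k=\operatorname{Tr}[\tilde\psi(t)\mathcal L_k\tilde\rho(t)]$ vanishes for all $t\in(t_1,t_2)$. **Theorem.** Suppose that for some $k$ there is a density matrix $\rho_k$ such that $\mathcal L_k\rho=-\rho+\rho_k$ for all density matrices $\rho$; the other $\mathcal L_j$ may be of any type. Then the optimal control $\tilde u_k$ has no singular subarcs, except for those on which it is unspecified and redundant. That is, if $(t_1,t_2)$ is a singular subarc of $\tilde u_k$, then every integrable variation of $\tilde u_k$ that vanishes outside $(t_1,t_2)$ (all other controls and $T$ being unchanged), whether or not it respects the bounds on $u_k$, leaves the performance index unchanged, $J=\tilde J$; in particular, every such variation that respects the bounds yields again an optimal control. -/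

import Mathlib

open MeasureTheory
open scoped ComplexOrder

/-- Operators on an `N`-dimensional Hilbert space. -/
abbrev Op (N : ℕ) : Type := Matrix (Fin N) (Fin N) ℂ

/-- Linear superoperators. -/
abbrev Superop (N : ℕ) : Type := Op N →ₗ[ℂ] Op N

/-- Density matrices: positive semidefinite with unit trace. -/
def IsDensityMatrix {N : ℕ} (ρ : Op N) : Prop :=
  ρ.PosSemidef ∧ ρ.trace = 1

/-- A superoperator which can stand on the right-hand side of a master equation: the flow it
generates preserves the trace and Hermiticity. (Complete positivity is not required.) -/
def IsLiouvillian {N : ℕ} (M : Superop N) : Prop :=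
  (∀ X : Op N, (M X).trace = 0) ∧
    ∀ X : Op N, M X.conjTranspose = (M X).conjTranspose

/-- The data of the terminal control problem with `m` independent linear controls, each with
its own interval of admissible values. -/
structure TerminalControlProblem (N m : ℕ) where
  /-- the uncontrolled part of the Liouvillian -/
  L₀ : Superop N
  /-- the controlled parts of the Liouvillian -/
  L : Fin m → Superop N
  /-- lower bounds of the controls -/
  umin : Fin m → ℝ
  /-- upper bounds of the controls -/
  umax : Fin m → ℝ
  /-- the observable -/
  O : Op N
  O_isHermitian : O.IsHermitian
  /-- the given initial state -/
  ρ₀ : Op N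
  ρ₀_isDensityMatrix : IsDensityMatrix ρ₀
  /-- the initial time -/
  ti : ℝ
  /-- `some t`: the final time is fixed and equal to `t`; `none`: the final time is free -/
  tf : Option ℝ
  /-- for all admissible values of the controls the total generator is a Liouvillian -/
  isLiouvillian : ∀ u : Fin m → ℝ, (∀ j, u j ∈ Set.Icc (umin j) (umax j)) →
    IsLiouvillian (L₀ + ∑ j, (u j : ℂ) • L j)

namespace TerminalControlProblem

variable {N m : ℕ} (P : TerminalControlProblem N m)

/-- The Liouvillian `L(u) = L₀ + ∑ⱼ uⱼ Lⱼ`. -/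
def liouvillian (u : Fin m → ℝ) : Superop N :=
  P.L₀ + ∑ j, (u j : ℂ) • P.L j

/-- `ρ` is the (Carathéodory) solution on `[ti, T]` of `dρ/dt = L(u(t)) ρ`, `ρ(ti) = ρ₀`, for the
integrable control functions `u`; the equation is written in integrated form, entry by entry. -/
def IsTrajectory (u : ℝ → Fin m → ℝ) (T : ℝ) (ρ : ℝ → Op N) : Prop :=
  (∀ j, IntervalIntegrable (fun t => u t j) volume P.ti T) ∧
  ContinuousOn ρ (Set.Icc P.ti T) ∧
  ∀ t ∈ Set.Icc P.ti T, ∀ a b,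
    ρ t a b = P.ρ₀ a b + ∫ s in P.ti..t, (P.liouvillian (u s) (ρ s)) a b

/-- Admissible processes: final time, controls within their bounds, and the state trajectory. -/
def IsAdmissible (u : ℝ → Fin m → ℝ) (T : ℝ) (ρ : ℝ → Op N) : Prop :=
  P.ti ≤ T ∧ (∀ t, P.tf = some t → T = t) ∧
  (∀ t ∈ Set.Icc P.ti T, ∀ j, u t j ∈ Set.Icc (P.umin j) (P.umax j)) ∧
  P.IsTrajectory u T ρ

/-- The performance index `J = Tr[O ρ(T)]`. -/
def performance (T : ℝ) (ρ : ℝ → Op N) : ℝ :=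
  (P.O * ρ T).trace.re

/-- Solutions of the terminal control problem. -/
def IsOptimal (u : ℝ → Fin m → ℝ) (T : ℝ) (ρ : ℝ → Op N) : Prop :=
  P.IsAdmissible u T ρ ∧
  ∀ u' T' ρ', P.IsAdmissible u' T' ρ' → P.performance T' ρ' ≤ P.performance T ρ

/-- Pontryagin's function `K(ρ, u, ψ) = Tr[ψ L(u) ρ]`. -/
def pontryagin (ρ : Op N) (u : Fin m → ℝ) (ψ : Op N) : ℂ :=
  (ψ * P.liouvillian u ρ).trace

/-- The costate `ψ` of the process `(u, T, ρ)`. It satisfies `dψ/dt = -∂K/∂ρ` on `[ti, T]` and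
the transversality condition `ψ(T) = O - J`. As `K` is linear in `ρ`, the component of the costate
equation along `X` is `d/dt Tr[ψ(t) X] = -K(X, u(t), ψ(t))`; it is written in integrated form. -/
def IsCostate (u : ℝ → Fin m → ℝ) (T : ℝ) (ρ ψ : ℝ → Op N) : Prop :=
  ContinuousOn ψ (Set.Icc P.ti T) ∧
  ψ T = P.O - (P.performance T ρ : ℂ) • (1 : Op N) ∧
  ∀ t ∈ Set.Icc P.ti T, ∀ X : Op N,
    (ψ t * X).trace = (ψ T * X).trace + ∫ s in t..T, P.pontryagin X (u s) (ψ s)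

/-- The switching function `∂K/∂u_k = Tr[ψ L_k ρ]`. -/
def switching (k : Fin m) (ρ ψ : Op N) : ℂ :=
  (ψ * P.L k ρ).trace

/-- The switching function is the derivative of Pontryagin's function in `u_k`. -/
theorem hasDerivAt_pontryagin (k : Fin m) (ρ ψ : Op N) (u : Fin m → ℝ) (x : ℝ) :
    HasDerivAt (fun y : ℝ => P.pontryagin ρ (Function.update u k y) ψ)
      (P.switching k ρ ψ) x := by
  have h : (fun y : ℝ => P.pontryagin ρ (Function.update u k y) ψ) =
      fun y : ℝ => P.pontryagin ρ (Function.update u k 0) ψ + (y : ℂ) * P.switching k ρ ψ := by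
    funext y
    simp only [pontryagin, switching, liouvillian, LinearMap.add_apply, LinearMap.sum_apply,
      LinearMap.smul_apply, mul_add, Matrix.trace_add, Matrix.mul_sum, Matrix.trace_sum,
      Matrix.mul_smul, Matrix.trace_smul, smul_eq_mul, add_assoc]
    congr 1
    rw [← Finset.add_sum_erase _ _ (Finset.mem_univ k),
      ← Finset.add_sum_erase _ (fun j => ((Function.update u k (0 : ℝ) j : ℝ) : ℂ) *
        (ψ * P.L j ρ).trace) (Finset.mem_univ k)]
    have e : ∀ z : ℝ, ∑ j ∈ Finset.univ.erase k, ((Function.update u k z j : ℝ) : ℂ) *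
        (ψ * P.L j ρ).trace = ∑ j ∈ Finset.univ.erase k, (u j : ℂ) * (ψ * P.L j ρ).trace := by
      intro z
      refine Finset.sum_congr rfl fun j hj => ?_
      rw [Function.update_of_ne (Finset.ne_of_mem_erase hj)]
    simp only [e, Function.update_self]
    push_cast
    ring
  rw [h]
  simpa using ((Complex.ofRealCLM.hasDerivAt (x := x)).mul_const
    (P.switching k ρ ψ)).const_add (P.pontryagin ρ (Function.update u k 0) ψ)

/-- `(t₁, t₂)` is a singular subarc of the `k`-th control of the process `(u, T, ρ)`: the switching
function vanishes identically on this nonempty interval. -/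
def IsSingularSubarc (k : Fin m) (u : ℝ → Fin m → ℝ) (T : ℝ) (ρ : ℝ → Op N) (t₁ t₂ : ℝ) : Prop :=
  P.ti ≤ t₁ ∧ t₁ < t₂ ∧ t₂ ≤ T ∧
  ∃ ψ : ℝ → Op N, P.IsCostate u T ρ ψ ∧
    ∀ t ∈ Set.Ioo t₁ t₂, P.switching k (ρ t) (ψ t) = 0

/-- On `[ti, T]`, `v` differs from `u` only in the `k`-th control, and only inside `(t₁, t₂)`. -/
def IsVariation (k : Fin m) (u v : ℝ → Fin m → ℝ) (T t₁ t₂ : ℝ) : Prop :=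
  ∀ t ∈ Set.Icc P.ti T, ∀ j, (j ≠ k ∨ t ∉ Set.Ioo t₁ t₂) → v t j = u t j

/-- The `k`-th control is redundant on `(t₁, t₂)`: every variation of it there, within the bounds
or not, leaves the performance index unchanged. -/
def IsRedundant (k : Fin m) (u : ℝ → Fin m → ℝ) (T : ℝ) (ρ : ℝ → Op N) (t₁ t₂ : ℝ) : Prop :=
  ∀ v ρ', P.IsVariation k u v T t₁ t₂ → P.IsTrajectory v T ρ' →
    P.performance T ρ' = P.performance T ρ

/-- The `k`-th control is unspecified on `(t₁, t₂)`: every variation of it there within the bounds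
is again a solution of the terminal control problem. -/
def IsUnspecified (k : Fin m) (u : ℝ → Fin m → ℝ) (T t₁ t₂ : ℝ) : Prop :=
  ∀ v ρ', P.IsVariation k u v T t₁ t₂ → P.IsAdmissible v T ρ' → P.IsOptimal v T ρ'

end TerminalControlProblem

/-! Linearity forces L_k X = -X + Tr[X] ρ_k for every X (`Superop.apply_of_densityMatrix`). Let ψ be
the costate of (u, ρ), and let ρ' be the trajectory of a variation v. By
`IsCostate.isPrimitiveOn_pairing`, Tr[ψρ'] has derivative (v_k - u_k) Tr[ψ L_k ρ'] almost
everywhere. For v = u this makes Tr[ψρ] a constant c, so vanishing of the switching function says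
exactly Tr[ψρ_k] = c on the subarc. Hence g = Tr[ψρ'] - c solves g' = -(v_k - u_k) g with g(ti) = 0,
and g = 0 by `IsPrimitiveOn.eq_zero_of_linear`. At T, transversality turns this into equality of the
two performances. Controls are merely integrable, so the calculus is that of absolutely continuous
functions. -/

/-! ### Closure properties of absolute continuity. -/

/-- Absolute continuity passes to a function whose increments are dominated. -/
theorem AbsolutelyContinuousOnInterval.of_dist_le {X Y : Type*} [PseudoMetricSpace X]
    [PseudoMetricSpace Y] {f : ℝ → X} {g : ℝ → Y} {a b : ℝ}
    (hg : AbsolutelyContinuousOnInterval g a b) (C : ℝ)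
    (h : ∀ x ∈ Set.uIcc a b, ∀ y ∈ Set.uIcc a b, dist (f x) (f y) ≤ C * dist (g x) (g y)) :
    AbsolutelyContinuousOnInterval f a b := by
  unfold AbsolutelyContinuousOnInterval at hg ⊢
  refine squeeze_zero' ?_ ?_ (by simpa using hg.const_mul C)
  · exact Filter.Eventually.of_forall fun _ => Finset.sum_nonneg fun _ _ => dist_nonneg
  · rw [Filter.eventually_inf_principal]
    refine Filter.Eventually.of_forall fun E hE => ?_
    rw [Finset.mul_sum]
    exact Finset.sum_le_sum fun i hi => h _ (hE.1 i hi).1 _ (hE.1 i hi).2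

theorem AbsolutelyContinuousOnInterval.const {X : Type*} [PseudoMetricSpace X] (c : X) (a b : ℝ) :
    AbsolutelyContinuousOnInterval (fun _ : ℝ => c) a b := by
  simpa [AbsolutelyContinuousOnInterval] using tendsto_const_nhds

theorem AbsolutelyContinuousOnInterval.sum {ι F : Type*} [SeminormedAddCommGroup F]
    (s : Finset ι) {f : ι → ℝ → F} {a b : ℝ}
    (hf : ∀ i ∈ s, AbsolutelyContinuousOnInterval (f i) a b) :
    AbsolutelyContinuousOnInterval (fun t => ∑ i ∈ s, f i t) a b := by
  classical
  induction s using Finset.induction_on with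
  | empty => simpa using AbsolutelyContinuousOnInterval.const (0 : F) a b
  | insert i s hi ih =>
    simp only [Finset.sum_insert hi]
    exact (hf i (Finset.mem_insert_self i s)).fun_add
      (ih fun j hj => hf j (Finset.mem_insert_of_mem hj))

/-- The range of `f` is bounded, and exp is Lipschitz on bounded intervals. -/
theorem AbsolutelyContinuousOnInterval.exp {f : ℝ → ℝ} {a b : ℝ}
    (hf : AbsolutelyContinuousOnInterval f a b) :
    AbsolutelyContinuousOnInterval (fun t => Real.exp (f t)) a b := by
  obtain ⟨C, hC⟩ := hf.exists_bound
  obtain ⟨K, hK⟩ := (Real.contDiff_exp (n := 1)).contDiffOn.exists_lipschitzOnWith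
    (s := Set.Icc (-C) C) (by decide) (convex_Icc _ _) isCompact_Icc
  exact hf.of_dist_le K fun x hx y hy =>
    hK.dist_le_mul _ (abs_le.1 (hC x hx)) _ (abs_le.1 (hC y hy))

/-! ### Almost-everywhere calculus and linear Carathéodory equations. -/

/-- `F` is absolutely continuous on `[a, b]` with almost everywhere derivative `f`. -/
structure IsPrimitiveOn {E : Type*} [NormedAddCommGroup E] [NormedSpace ℝ E]
    (F f : ℝ → E) (a b : ℝ) : Prop where
  absolutelyContinuous : AbsolutelyContinuousOnInterval F a b
  ae_hasDerivAt : ∀ᵐ x, x ∈ Set.uIcc a b → HasDerivAt F (f x) x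

namespace IsPrimitiveOn

variable {E : Type*} [NormedAddCommGroup E] [NormedSpace ℝ E] {F G f g : ℝ → E} {a b : ℝ}

/-- A function given by an indefinite integral is a primitive of the integrand. -/
theorem of_eq_integral [CompleteSpace E] (hf : IntervalIntegrable f volume a b) {c : ℝ}
    (hc : c ∈ Set.uIcc a b) (F₀ : E)
    (h : ∀ t ∈ Set.uIcc a b, F t = F₀ + ∫ s in c..t, f s) : IsPrimitiveOn F f a b := by
  have hsub : ∀ x ∈ Set.uIcc a b, ∀ y ∈ Set.uIcc a b, IntervalIntegrable f volume x y :=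
    fun x hx y hy => hf.mono_set (Set.uIcc_subset_uIcc hx hy)
  constructor
  · refine (hf.norm.absolutelyContinuousOnInterval_intervalIntegral hc).of_dist_le 1 ?_
    intro x hx y hy
    rw [h x hx, h y hy, dist_add_left, dist_eq_norm, Real.dist_eq,
      intervalIntegral.integral_interval_sub_left (hsub c hc x hx) (hsub c hc y hy),
      intervalIntegral.integral_interval_sub_left (hsub c hc x hx).norm (hsub c hc y hy).norm,
      one_mul]
    exact intervalIntegral.norm_integral_le_abs_integral_norm
  -- `F` is controlled only on the interval, so the endpoints, a null set, are discarded to get a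
  -- neighbourhood.
  · have h₁ : ∀ᵐ x : ℝ, x ≠ min a b := by simp [ae_iff, measure_singleton]
    have h₂ : ∀ᵐ x : ℝ, x ≠ max a b := by simp [ae_iff, measure_singleton]
    filter_upwards [hf.ae_hasDerivAt_integral, h₁, h₂] with x hx hx₁ hx₂ hxm
    refine ((hx hxm c hc).const_add F₀).congr_of_eventuallyEq ?_
    have hlt : min a b < x ∧ x < max a b :=
      ⟨lt_of_le_of_ne hxm.1 hx₁.symm, lt_of_le_of_ne hxm.2 hx₂⟩
    filter_upwards [Icc_mem_nhds hlt.1 hlt.2] with y hy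
    exact h y hy

theorem const (c : E) (a b : ℝ) : IsPrimitiveOn (fun _ => c) (fun _ => 0) a b :=
  ⟨.const c a b, Filter.Eventually.of_forall fun x _ => hasDerivAt_const x c⟩

theorem congr_deriv (hF : IsPrimitiveOn F f a b) (h : ∀ x ∈ Set.uIcc a b, f x = g x) :
    IsPrimitiveOn F g a b :=
  ⟨hF.1, hF.2.mono fun x hx hxm => h x hxm ▸ hx hxm⟩

theorem sub (hF : IsPrimitiveOn F f a b) (hG : IsPrimitiveOn G g a b) :
    IsPrimitiveOn (fun t => F t - G t) (fun t => f t - g t) a b := by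
  refine ⟨hF.1.fun_sub hG.1, ?_⟩
  filter_upwards [hF.2, hG.2] with x hx hy hxm
  exact (hx hxm).fun_sub (hy hxm)

theorem sum {ι : Type*} (s : Finset ι) {F f : ι → ℝ → E}
    (h : ∀ i ∈ s, IsPrimitiveOn (F i) (f i) a b) :
    IsPrimitiveOn (fun t => ∑ i ∈ s, F i t) (fun t => ∑ i ∈ s, f i t) a b := by
  refine ⟨.sum s fun i hi => (h i hi).1, ?_⟩
  have : ∀ᵐ x, ∀ i ∈ s, x ∈ Set.uIcc a b → HasDerivAt (F i) (f i x) x :=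
    (Finset.eventually_all s).2 fun i hi => (h i hi).2
  filter_upwards [this] with x hx hxm
  exact HasDerivAt.fun_sum fun i hi => hx i hi hxm

/-- General scalars let one product rule serve both the real integrating factor and complex matrix
entries. -/
theorem smul {𝕜 : Type*} [NormedRing 𝕜] [NormedAlgebra ℝ 𝕜] [Module 𝕜 E] [NormSMulClass 𝕜 E]
    [IsScalarTower ℝ 𝕜 E] {W w : ℝ → 𝕜} (hW : IsPrimitiveOn W w a b)
    (hF : IsPrimitiveOn F f a b) :
    IsPrimitiveOn (fun t => W t • F t) (fun t => W t • f t + w t • F t) a b := by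
  refine ⟨hW.1.fun_smul hF.1, ?_⟩
  have : IsBoundedSMul 𝕜 E := .of_norm_smul_le fun r x => (norm_smul r x).le
  filter_upwards [hW.2, hF.2] with x hx hy hxm
  exact (hx hxm).fun_smul (hy hxm)

theorem exp {W w : ℝ → ℝ} (hW : IsPrimitiveOn W w a b) :
    IsPrimitiveOn (fun t => Real.exp (W t)) (fun t => Real.exp (W t) * w t) a b :=
  ⟨hW.1.exp, hW.2.mono fun _ hx hxm => (hx hxm).exp⟩

theorem eq_of_deriv_eq_zero (hF : IsPrimitiveOn F f a b) (h : ∀ x ∈ Set.uIcc a b, f x = 0)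
    {x y : ℝ} (hx : x ∈ Set.uIcc a b) (hy : y ∈ Set.uIcc a b) : F x = F y := by
  obtain ⟨C, hC⟩ := hF.1.const_of_ae_hasDerivAt_zero (hF.congr_deriv h).2
  rw [hC x hx, hC y hy]

/-- A solution of the homogeneous linear Carathéodory equation `g' = -w g` with integrable `w`
which vanishes at one point vanishes identically. -/
theorem eq_zero_of_linear {w : ℝ → ℝ} (hw : IntervalIntegrable w volume a b)
    (hF : IsPrimitiveOn F (fun t => -(w t • F t)) a b) {x₀ : ℝ} (hx₀ : x₀ ∈ Set.uIcc a b)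
    (h₀ : F x₀ = 0) {x : ℝ} (hx : x ∈ Set.uIcc a b) : F x = 0 := by
  have hW : IsPrimitiveOn (fun t => ∫ s in a..t, w s) w a b :=
    of_eq_integral hw Set.left_mem_uIcc 0 (by simp)
  -- Integrating factor: exp(W) F has zero derivative almost everywhere.
  have key := (hW.exp.smul hF).eq_of_deriv_eq_zero
    (fun t _ => by rw [smul_neg, smul_smul, neg_add_cancel]) hx hx₀
  rw [h₀, smul_zero] at key
  exact (smul_eq_zero.1 key).resolve_left (Real.exp_ne_zero _)

end IsPrimitiveOn

/-! ### Linear extension from density matrices. -/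

/-- A linear map which vanishes on density matrices vanishes. -/
theorem LinearMap.eq_zero_of_densityMatrix {N : ℕ} {V : Type*} [AddCommGroup V] [Module ℂ V]
    (D : Op N →ₗ[ℂ] V) (hD : ∀ σ, IsDensityMatrix σ → D σ = 0) : D = 0 := by
  have hpos : ∀ A : Op N, A.PosSemidef → D A = 0 := by
    intro A hA
    by_cases ht : A.trace = 0
    · rw [hA.trace_eq_zero_iff.1 ht, map_zero]
    · have hd : IsDensityMatrix (A.trace⁻¹ • A) :=
        ⟨hA.smul (inv_nonneg.2 hA.trace_nonneg), by
          rw [Matrix.trace_smul, smul_eq_mul, inv_mul_cancel₀ ht]⟩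
      have := hD _ hd
      rw [map_smul] at this
      exact (smul_eq_zero.1 this).resolve_left (inv_ne_zero ht)
  have hpol : ∀ x y : Fin N → ℂ, D (Matrix.vecMulVec x (star y)) = 0 := by
    intro x y
    -- Polarization writes each rank-one operator through positive semidefinite ones; matrix units
    -- are a special case.
    have e : Matrix.vecMulVec x (star y) = (1 / 4 : ℂ) •
        (Matrix.vecMulVec (x + y) (star (x + y))
          - Matrix.vecMulVec (x - y) (star (x - y))
          + Complex.I • Matrix.vecMulVec (x + Complex.I • y) (star (x + Complex.I • y))
          - Complex.I • Matrix.vecMulVec (x - Complex.I • y) (star (x - Complex.I • y))) := by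
      ext i j
      simp [Matrix.vecMulVec_apply]
      ring_nf
      simp
      ring
    rw [e]
    simp only [map_smul, map_add, map_sub, hpos _ (Matrix.posSemidef_vecMulVec_self_star _)]
    simp
  refine Matrix.ext_linearMap ℂ fun i j => LinearMap.ext_ring ?_
  have := hpol (Pi.single i 1) (Pi.single j 1)
  have e : Matrix.vecMulVec (Pi.single i 1) (star (Pi.single j (1 : ℂ))) = Matrix.single i j 1 := by
    ext a b
    simp [Matrix.vecMulVec_apply, Matrix.single_apply, Pi.single_apply]
    grind
  rw [e] at this
  simpa using this

/-- A superoperator relaxing every density matrix to `ρk` has the linear form `-X + Tr[X] ρk`. -/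
theorem Superop.apply_of_densityMatrix {N : ℕ} (M : Superop N) (ρk : Op N)
    (h : ∀ σ : Op N, IsDensityMatrix σ → M σ = -σ + ρk) (X : Op N) :
    M X = -X + X.trace • ρk := by
  have key := LinearMap.eq_zero_of_densityMatrix
    (M + LinearMap.id - (Matrix.traceLinearMap (Fin N) ℂ ℂ).smulRight ρk) (by
      intro σ hσ
      simp [h σ hσ, hσ.2])
  have := LinearMap.congr_fun key X
  simp only [LinearMap.sub_apply, LinearMap.add_apply, LinearMap.id_apply,
    LinearMap.smulRight_apply, Matrix.traceLinearMap_apply, LinearMap.zero_apply] at this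
  rw [eq_neg_add_iff_add_eq, add_comm]
  exact sub_eq_zero.1 this

/-! ### Pairing the costate with varied trajectories. -/

namespace TerminalControlProblem

variable {N m : ℕ} (P : TerminalControlProblem N m)

theorem liouvillian_apply (u : Fin m → ℝ) (X : Op N) :
    P.liouvillian u X = P.L₀ X + ∑ j, (u j : ℂ) • P.L j X := by
  simp [liouvillian]

/-- Changing a single control changes the Liouvillian by a multiple of its superoperator. -/
theorem liouvillian_sub_apply {k : Fin m} {u v : Fin m → ℝ} (h : ∀ j, j ≠ k → v j = u j)
    (X : Op N) :
    P.liouvillian v X - P.liouvillian u X = ((v k - u k : ℝ) : ℂ) • P.L k X := by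
  rw [liouvillian_apply, liouvillian_apply, add_sub_add_left_eq_sub, ← Finset.sum_sub_distrib,
    Finset.sum_eq_single k]
  · rw [← sub_smul, Complex.ofReal_sub]
  · intro j _ hj
    rw [h j hj, sub_self]
  · simp

theorem pontryagin_sub {k : Fin m} {u v : Fin m → ℝ} (h : ∀ j, j ≠ k → v j = u j)
    (X ψ : Op N) :
    P.pontryagin X v ψ - P.pontryagin X u ψ = ((v k - u k : ℝ) : ℂ) * P.switching k X ψ := by
  rw [pontryagin, pontryagin, switching, ← Matrix.trace_sub, ← Matrix.mul_sub,
    P.liouvillian_sub_apply h, Matrix.mul_smul, Matrix.trace_smul, smul_eq_mul]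

/-- Integrability of an expression affine in the controls and linear in a continuous operator. -/
theorem intervalIntegrable_affine {a b : ℝ} (hab : a ≤ b) {u : ℝ → Fin m → ℝ}
    (hu : ∀ j, IntervalIntegrable (fun t => u t j) volume a b) {X : ℝ → Op N}
    (hX : ContinuousOn X (Set.Icc a b)) (φ₀ : Op N →ₗ[ℂ] ℂ) (φ : Fin m → Op N →ₗ[ℂ] ℂ) :
    IntervalIntegrable (fun t => φ₀ (X t) + ∑ j, (u t j : ℂ) * φ j (X t)) volume a b := by
  rw [← Set.uIcc_of_le hab] at hX
  have hc : ∀ χ : Op N →ₗ[ℂ] ℂ, ContinuousOn (fun t => χ (X t)) (Set.uIcc a b) := fun χ =>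
    χ.continuous_of_finiteDimensional.comp_continuousOn hX
  refine (hc φ₀).intervalIntegrable.add ?_
  have h : ∀ j, IntervalIntegrable (fun t => (u t j : ℂ)) volume a b := fun j =>
    ⟨(hu j).1.ofReal, (hu j).2.ofReal⟩
  have := IntervalIntegrable.sum (μ := volume) Finset.univ
    fun j (_ : j ∈ Finset.univ) => (h j).mul_continuousOn (hc (φ j))
  have e : (fun t => ∑ j, (u t j : ℂ) * φ j (X t)) = ∑ j, fun t => (u t j : ℂ) * φ j (X t) := by
    ext t
    simp
  rw [e]
  exact this

variable {P} {u v : ℝ → Fin m → ℝ} {T : ℝ} {ρ ρ' ψ : ℝ → Op N}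

theorem IsTrajectory.isPrimitiveOn_entry (hT : P.ti ≤ T) (h : P.IsTrajectory v T ρ)
    (a b : Fin N) :
    IsPrimitiveOn (fun t => ρ t a b) (fun t => P.liouvillian (v t) (ρ t) a b) P.ti T := by
  refine .of_eq_integral ?_ Set.left_mem_uIcc (P.ρ₀ a b) fun t ht =>
    h.2.2 t (Set.uIcc_of_le hT ▸ ht) a b
  have := intervalIntegrable_affine hT h.1 h.2.1 (Matrix.entryLinearMap ℂ ℂ a b ∘ₗ P.L₀)
    fun j => Matrix.entryLinearMap ℂ ℂ a b ∘ₗ P.L j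
  convert this using 2 with t
  simp [liouvillian_apply, Matrix.sum_apply]

theorem IsCostate.isPrimitiveOn_entry (hT : P.ti ≤ T)
    (hu : ∀ j, IntervalIntegrable (fun t => u t j) volume P.ti T)
    (h : P.IsCostate u T ρ ψ) (a b : Fin N) :
    IsPrimitiveOn (fun t => ψ t a b)
      (fun t => -P.pontryagin (Matrix.single b a 1) (u t) (ψ t)) P.ti T := by
  refine .of_eq_integral ?_ Set.right_mem_uIcc (ψ T a b) fun t ht => ?_
  · refine IntervalIntegrable.neg ?_
    let φ (X : Op N) : Op N →ₗ[ℂ] ℂ :=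
      Matrix.traceLinearMap (Fin N) ℂ ℂ ∘ₗ LinearMap.mulRight ℂ X
    have := intervalIntegrable_affine hT hu h.1 (φ (P.L₀ (Matrix.single b a 1)))
      fun j => φ (P.L j (Matrix.single b a 1))
    convert this using 2 with t
    simp [φ, pontryagin, liouvillian_apply, mul_add, Matrix.mul_sum, Matrix.trace_sum]
  · have := h.2.2 t (Set.uIcc_of_le hT ▸ ht) (Matrix.single b a 1)
    -- The costate equation is based at `T`; reversing the integral produces the minus sign.
    rw [intervalIntegral.integral_neg, ← intervalIntegral.integral_symm]
    simpa [Matrix.trace_mul_single] using this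

theorem IsTrajectory.isPrimitiveOn_trace (hT : P.ti ≤ T) (h : P.IsTrajectory v T ρ) :
    IsPrimitiveOn (fun t => (ρ t).trace) (fun t => (P.liouvillian (v t) (ρ t)).trace) P.ti T :=
  .sum Finset.univ fun a _ => h.isPrimitiveOn_entry hT a a

/-- The pairing of a costate for `u` with a trajectory for `v` has derivative `K(v) - K(u)`. -/
theorem IsCostate.isPrimitiveOn_pairing (hT : P.ti ≤ T)
    (hu : ∀ j, IntervalIntegrable (fun t => u t j) volume P.ti T)
    (h : P.IsCostate u T ρ ψ) (h' : P.IsTrajectory v T ρ') :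
    IsPrimitiveOn (fun t => (ψ t * ρ' t).trace)
      (fun t => P.pontryagin (ρ' t) (v t) (ψ t) - P.pontryagin (ρ' t) (u t) (ψ t)) P.ti T := by
  have key := IsPrimitiveOn.sum Finset.univ fun a (_ : a ∈ Finset.univ) =>
    IsPrimitiveOn.sum Finset.univ fun b (_ : b ∈ Finset.univ) =>
      (h.isPrimitiveOn_entry hT hu a b).smul (h'.isPrimitiveOn_entry hT b a)
  refine IsPrimitiveOn.congr_deriv key fun t _ => ?_
  -- Expanding ρ' in matrix units reassembles the entrywise costate derivatives into K(ρ', u, ψ).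
  have e : P.pontryagin (ρ' t) (u t) (ψ t) =
      ∑ a, ∑ b, P.pontryagin (Matrix.single b a 1) (u t) (ψ t) * ρ' t b a := by
    have e₁ : ρ' t = ∑ b, ∑ a, ρ' t b a • Matrix.single b a (1 : ℂ) := by
      conv_lhs => rw [Matrix.matrix_eq_sum_single (ρ' t)]
      simp [Matrix.smul_single]
    rw [Finset.sum_comm]
    conv_lhs => rw [e₁]
    simp only [pontryagin, map_sum, map_smul, Matrix.mul_sum, Matrix.trace_sum, Matrix.mul_smul,
      Matrix.trace_smul, smul_eq_mul, mul_comm]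
  simp only [smul_eq_mul, Finset.sum_add_distrib, neg_mul, Finset.sum_neg_distrib]
  rw [e, ← sub_eq_add_neg]
  rfl

theorem IsTrajectory.initial (hT : P.ti ≤ T) (h : P.IsTrajectory v T ρ) : ρ P.ti = P.ρ₀ := by
  ext a b
  simpa using h.2.2 P.ti (Set.left_mem_Icc.2 hT) a b

theorem IsTrajectory.trace_eq_one (hT : P.ti ≤ T) (h : P.IsTrajectory v T ρ)
    (htr : ∀ t ∈ Set.Icc P.ti T, ∀ X, (P.liouvillian (v t) X).trace = 0) {t : ℝ}
    (ht : t ∈ Set.Icc P.ti T) : (ρ t).trace = 1 := by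
  rw [← Set.uIcc_of_le hT] at htr ht
  rw [(h.isPrimitiveOn_trace hT).eq_of_deriv_eq_zero (fun s hs => htr s hs _) ht
    Set.left_mem_uIcc, h.initial hT, P.ρ₀_isDensityMatrix.2]

/-- The real part of the final pairing is the gain over the reference process. -/
theorem IsCostate.re_pairing_final (h : P.IsCostate u T ρ ψ) (h' : (ρ' T).trace = 1) :
    (ψ T * ρ' T).trace.re = P.performance T ρ' - P.performance T ρ := by
  rw [h.2.1, sub_mul, Matrix.trace_sub, Matrix.smul_mul, one_mul, Matrix.trace_smul, h']
  simp [performance]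

theorem isRedundant_of_isSingularSubarc {k : Fin m} {ρk : Op N} (hρk : ρk.trace = 1)
    (hLk : ∀ X : Op N, P.L k X = -X + X.trace • ρk) (hadm : P.IsAdmissible u T ρ)
    {t₁ t₂ : ℝ} (hsing : P.IsSingularSubarc k u T ρ t₁ t₂) :
    P.IsRedundant k u T ρ t₁ t₂ := by
  intro v ρ' hv hρ'
  obtain ⟨hT, -, hbd, hρ⟩ := hadm
  obtain ⟨-, -, -, ψ, hψ, hsw⟩ := hsing
  have hI := Set.uIcc_of_le hT
  have hvj : ∀ t ∈ Set.Icc P.ti T, ∀ j, j ≠ k → v t j = u t j := fun t ht j hj =>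
    hv t ht j (.inl hj)
  have htru : ∀ t ∈ Set.Icc P.ti T, ∀ X, (P.liouvillian (u t) X).trace = 0 := fun t ht =>
    (P.isLiouvillian (u t) (hbd t ht)).1
  -- `v` may violate the bounds, but L_k maps into traceless operators because Tr ρ_k = 1.
  have htrv : ∀ t ∈ Set.Icc P.ti T, ∀ X, (P.liouvillian (v t) X).trace = 0 := by
    intro t ht X
    rw [← sub_add_cancel (P.liouvillian (v t) X) (P.liouvillian (u t) X),
      P.liouvillian_sub_apply (hvj t ht), Matrix.trace_add, htru t ht, hLk]
    simp [hρk]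
  have htr : ∀ t ∈ Set.Icc P.ti T, (ρ t).trace = 1 := fun t => hρ.trace_eq_one hT htru
  have htr' : ∀ t ∈ Set.Icc P.ti T, (ρ' t).trace = 1 := fun t => hρ'.trace_eq_one hT htrv
  have hsw_eq : ∀ t X, P.switching k X (ψ t) =
      -(ψ t * X).trace + X.trace * (ψ t * ρk).trace := by
    intro t X
    simp [switching, hLk, mul_add]
  have hTmem : T ∈ Set.Icc P.ti T := Set.right_mem_Icc.2 hT
  set c := (ψ T * ρ T).trace with hc
  have hconst : ∀ t ∈ Set.Icc P.ti T, (ψ t * ρ t).trace = c := fun t ht =>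
    (hψ.isPrimitiveOn_pairing hT hρ.1 hρ).eq_of_deriv_eq_zero (fun s _ => sub_self _)
      (hI ▸ ht) Set.right_mem_uIcc
  have hρk_pair : ∀ t ∈ Set.Icc P.ti T, t ∈ Set.Ioo t₁ t₂ → (ψ t * ρk).trace = c := by
    intro t ht hts
    have := hsw t hts
    rw [hsw_eq, htr t ht, hconst t ht, one_mul] at this
    exact (neg_add_eq_zero.1 this).symm
  have hg := (hψ.isPrimitiveOn_pairing hT hρ.1 hρ').sub (.const c P.ti T)
  have hzero := (hg.congr_deriv (g := fun t => -((v t k - u t k) • ((ψ t * ρ' t).trace - c)))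
    fun t ht => by
      rw [hI] at ht
      rw [sub_zero, P.pontryagin_sub (hvj t ht), Complex.real_smul]
      -- Off the subarc v_k = u_k, so both sides vanish and the value of Tr[ψρ_k] is not needed
      -- there.
      by_cases hts : t ∈ Set.Ioo t₁ t₂
      · rw [hsw_eq, htr' t ht, hρk_pair t ht hts]
        ring
      · simp [hv t ht k (.inr hts)]).eq_zero_of_linear ((hρ'.1 k).sub (hρ.1 k))
    Set.left_mem_uIcc (by
      rw [hρ'.initial hT, ← hρ.initial hT, hconst _ (Set.left_mem_Icc.2 hT), sub_self])
    Set.right_mem_uIcc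
  have hre := congrArg Complex.re (sub_eq_zero.1 hzero)
  -- Applied to ρ itself, the final-time formula gives Re c = 0.
  rw [hc, hψ.re_pairing_final (htr' T hTmem), hψ.re_pairing_final (htr T hTmem)] at hre
  linarith

theorem IsOptimal.isUnspecified_of_isRedundant {k : Fin m} (hopt : P.IsOptimal u T ρ)
    {t₁ t₂ : ℝ} (h : P.IsRedundant k u T ρ t₁ t₂) : P.IsUnspecified k u T t₁ t₂ :=
  fun v ρ' hv hadm => ⟨hadm, fun u' T' σ hσ =>
    (hopt.2 u' T' σ hσ).trans_eq (h v ρ' hv hadm.2.2.2).symm⟩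

end TerminalControlProblem

theorem theorem4 {N m : ℕ} (P : TerminalControlProblem N m) (k : Fin m) (ρk : Op N)
    (hρk : IsDensityMatrix ρk)
    (hLk : ∀ σ : Op N, IsDensityMatrix σ → P.L k σ = -σ + ρk)
    (u : ℝ → Fin m → ℝ) (T : ℝ) (ρ : ℝ → Op N) (hopt : P.IsOptimal u T ρ)
    (t₁ t₂ : ℝ) (hsing : P.IsSingularSubarc k u T ρ t₁ t₂) :
    P.IsUnspecified k u T t₁ t₂ ∧ P.IsRedundant k u T ρ t₁ t₂ := by
  have h : P.IsRedundant k u T ρ t₁ t₂ :=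
    TerminalControlProblem.isRedundant_of_isSingularSubarc hρk.2
      ((P.L k).apply_of_densityMatrix ρk hLk) hopt.1 hsing
  exact ⟨hopt.isUnspecified_of_isRedundant h, h⟩
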